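/- Let $n$ be a natural number and $\lambda>0$ real. Let $G=SU(n,1)$ be the group of complex matrices $g=\begin{pmatrix}a&v\\ w^t&d\end{pmatrix}$ (with $a$ of size $n\times n$) of determinant $1$ preserving the Hermitian form $|x_1|^2+\dots+|x_n|^2-|x_{n+1}|^2$. It acts on the open unit ball $\mathbb{B}^n\subset\mathbb{C}^n$ by $g.z=(az+v)/(w^tz+d)$. Let $\widetilde G$ be its universal covering group, acting on $\mathbb{B}^n$ through $G$, and let $j_\lambda:\widetilde G\times\mathbb{B}^n\to\mathbb{C}$ be the continuous lift of $(w^tz+d)^{-\lambda}$ with $j_\lambda(1,z)=1$. Let $A^2_\lambda(\mathbb{B}^n)$ be the Hilbert space of (holomorphic) functions on $\mathbb{B}^n$ with reproducing kernel $K_\lambda(z,w)=(1-\langle z,w\rangle)^{-\lambda}$, $\langle z,w\rangle=\sum_i z_i\overline{w_i}$ (for $\lambda>n$ this is the weighted Bergman space of weight $\lambda$). For $g\in\widetilde G$ put $$(\pi_\lambda(g)f)(z)=j_\lambda(g^{-1},z)\,f(g^{-1}.z).$$ Let $H$ be a subgroup of $G$, let $\widetilde H\subset\widetilde G$ be its inverse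 image, and let $z_0\in\mathbb{B}^n$. For $h\in\widetilde H$ put $D_\lambda(h)=j_\lambda(h,z_0)$, and for $f\in A^2_\lambda(\mathbb{B}^n)$ define $R_\lambda f:\widetilde H\to\mathbb{C}$ by $$R_\lambda f(h)=D_\lambda(h)\,f(h.z_0).$$ For $k$ in the stabilizer $\widetilde H_{z_0}$ of $z_0$ in $\widetilde H$ put $\chi_\lambda(k)=j_\lambda(k,z_0)^{-1}$. Let $\tau_\lambda$ be the left regular action on functions on $\widetilde H$, $(\tau_\lambda(h_1)F)(h)=F(h_1^{-1}h)$. Proposition. Let $f\in A^2_\lambda(\mathbb{B}^n)$. Then $R_\lambda f(hk)=\chi_\lambda(k)^{-1}R_\lambda f(h)$ for all $h\in\widetilde H$ and $k\in\widetilde H_{z_0}$. Moreover, for every $h_1\in\widetilde H$ the function $\pi_\lambda(h_1)f$ belongs to $A^2_\lambda(\mathbb{B}^n)$, and for all $h\in\widetilde H$ $$R_\lambda(\pi_\lambda(h_1)f)(h)=(\tau_\lambda(h_1)R_\lambda f)(h).$$ -/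

import Mathlib

open scoped unitInterval ComplexConjugate

noncomputable section

namespace BallRestriction

/-! ### The universal covering group of a topological group -/

section UniversalCover

variable (G : Type*) [Group G] [TopologicalSpace G] [IsTopologicalGroup G]

/-- The group (under pointwise multiplication) of continuous paths `[0,1] → G` that start at `1`. -/
def BasedPaths : Subgroup C(I, G) where
  carrier := {γ | γ 0 = 1}
  mul_mem' {a b} ha hb := by
    simp only [Set.mem_ofPred_eq] at ha hb ⊢
    simp [ha, hb]
  one_mem' := by simp
  inv_mem' {a} ha := by
    simp only [Set.mem_ofPred_eq] at ha ⊢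
    simp [ha]

variable {G}

theorem homotopicRel_mul {a b c d : C(I, G)} {S : Set I} (h₁ : a.HomotopicRel b S)
    (h₂ : c.HomotopicRel d S) : (a * c).HomotopicRel (b * d) S := by
  obtain ⟨F⟩ := h₁
  obtain ⟨K⟩ := h₂
  exact ⟨{ toFun := fun p => F p * K p
           continuous_toFun := by fun_prop
           map_zero_left := by simp
           map_one_left := by simp
           prop' := fun t x hx => by
            have h1 := F.eq_fst t hx
            have h2 := K.eq_fst t hx
            simp [h1, h2] }⟩

theorem homotopicRel_inv {a b : C(I, G)} {S : Set I} (h₁ : a.HomotopicRel b S) :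
    (a⁻¹).HomotopicRel (b⁻¹) S := by
  obtain ⟨F⟩ := h₁
  exact ⟨{ toFun := fun p => (F p)⁻¹
           continuous_toFun := by fun_prop
           map_zero_left := by simp
           map_one_left := by simp
           prop' := fun t x hx => by
            have h1 := F.eq_fst t hx
            simp [h1] }⟩

variable (G)

/-- The based paths that are homotopic, relative to the endpoints `0` and `1`, to the constant
path at `1` (in particular they are loops). -/
def NullPaths : Subgroup (BasedPaths G) where
  carrier := {γ | (γ : C(I, G)).HomotopicRel 1 {0, 1}}
  mul_mem' {a b} ha hb := by
    have := homotopicRel_mul ha hb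
    simpa using this
  one_mem' := ContinuousMap.HomotopicRel.refl _
  inv_mem' {a} ha := by
    have := homotopicRel_inv ha
    simpa using this

instance : (NullPaths G).Normal where
  conj_mem n hn g := by
    have := homotopicRel_mul (homotopicRel_mul
      (ContinuousMap.HomotopicRel.refl (S := {0, 1}) (g : C(I, G))) hn)
      (ContinuousMap.HomotopicRel.refl (S := {0, 1}) (g : C(I, G))⁻¹)
    change ((g * n * g⁻¹ : BasedPaths G) : C(I, G)).HomotopicRel 1 {0, 1}
    simpa using this

/-- The universal covering group of (the identity component of) `G`: the group of homotopy classes,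
relative to the endpoints, of paths in `G` that start at `1`, with pointwise multiplication.
Two based paths `γ`, `γ'` are identified exactly when `γ⁻¹ * γ'` is homotopic to the constant path
relative to the endpoints, that is, when `γ` and `γ'` are homotopic relative to the endpoints. -/
abbrev UniversalCover : Type _ := BasedPaths G ⧸ NullPaths G

variable {G}

theorem mk_eq_mk_iff (γ γ' : BasedPaths G) :
    (QuotientGroup.mk γ : UniversalCover G) = QuotientGroup.mk γ' ↔
      (γ : C(I, G)).HomotopicRel (γ' : C(I, G)) {0, 1} := by
  rw [QuotientGroup.eq]
  change ((γ⁻¹ * γ' : BasedPaths G) : C(I, G)).HomotopicRel 1 {0, 1} ↔ _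
  constructor
  · intro h
    have := homotopicRel_mul (ContinuousMap.HomotopicRel.refl (S := {0, 1}) (γ : C(I, G))) h
    simpa using this.symm
  · intro h
    have := homotopicRel_mul
      (ContinuousMap.HomotopicRel.refl (S := {0, 1}) (γ : C(I, G))⁻¹) h.symm
    simpa using this

/-- The covering homomorphism: it sends the class of a path to the endpoint of the path. -/
def UniversalCover.proj : UniversalCover G →* G :=
  QuotientGroup.lift (NullPaths G)
    { toFun := fun γ => (γ : C(I, G)) 1
      map_one' := rfl
      map_mul' := fun _ _ => rfl }
    (fun γ hγ => by
      have h : (γ : C(I, G)) 1 = (1 : C(I, G)) 1 :=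
        ContinuousMap.HomotopicRel.fst_eq_snd (S := {0, 1}) hγ (by simp)
      exact h)

end UniversalCover

/-! ### The group `SU(n,1)` and its action on the unit ball -/

/-- The Hermitian form of signature `(n,1)`. -/
def formJ (n : ℕ) : Matrix (Fin n ⊕ Unit) (Fin n ⊕ Unit) ℂ :=
  Matrix.fromBlocks 1 0 0 (-1)

/-- `SU(n,1)`: the matrices of determinant one that preserve the Hermitian form
`|x₁|² + ⋯ + |xₙ|² - |xₙ₊₁|²`. -/
def SU (n : ℕ) : Subgroup (Matrix.SpecialLinearGroup (Fin n ⊕ Unit) ℂ) where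
  carrier := {g | (g.1).conjTranspose * formJ n * g.1 = formJ n}
  mul_mem' {a b} ha hb := by
    simp only [Set.mem_ofPred_eq] at ha hb ⊢
    calc (a * b).1.conjTranspose * formJ n * (a * b).1
        = b.1.conjTranspose * (a.1.conjTranspose * formJ n * a.1) * b.1 := by
          change (a.1 * b.1).conjTranspose * formJ n * (a.1 * b.1) = _
          simp only [Matrix.conjTranspose_mul, Matrix.mul_assoc]
      _ = formJ n := by rw [ha, hb]
  one_mem' := by simp
  inv_mem' {a} ha := by
    simp only [Set.mem_ofPred_eq] at ha ⊢
    have h1 : a.1 * (a⁻¹).1 = 1 := congrArg Subtype.val (mul_inv_cancel a)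
    have h2 : (a⁻¹).1.conjTranspose * a.1.conjTranspose = 1 := by
      rw [← Matrix.conjTranspose_mul, h1, Matrix.conjTranspose_one]
    calc (a⁻¹).1.conjTranspose * formJ n * (a⁻¹).1
        = (a⁻¹).1.conjTranspose * (a.1.conjTranspose * formJ n * a.1) * (a⁻¹).1 := by rw [ha]
      _ = ((a⁻¹).1.conjTranspose * a.1.conjTranspose) * formJ n * (a.1 * (a⁻¹).1) := by
          simp only [Matrix.mul_assoc]
      _ = formJ n := by rw [h1, h2]; simp

/-- The open unit ball of `ℂⁿ` with the Euclidean norm. -/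
abbrev Ball (n : ℕ) : Type := {z : EuclideanSpace ℂ (Fin n) // ‖z‖ < 1}

variable {n : ℕ}

/-- For `g = (a v; wᵗ d)`, the vector `a z + v`. -/
def num (g : SU n) (z : Ball n) (i : Fin n) : ℂ :=
  ∑ k, g.1.1 (.inl i) (.inl k) * z.1 k + g.1.1 (.inl i) (.inr ())

/-- For `g = (a v; wᵗ d)`, the scalar `wᵗ z + d`. -/
def den (g : SU n) (z : Ball n) : ℂ :=
  ∑ k, g.1.1 (.inr ()) (.inl k) * z.1 k + g.1.1 (.inr ()) (.inr ())

theorem norm_num_den (g : SU n) (z : Ball n) :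
    ∑ i, ‖num g z i‖ ^ 2 - ‖den g z‖ ^ 2 = ‖z.1‖ ^ 2 - 1 := by
  have hg : (g.1.1).conjTranspose * formJ n * g.1.1 = formJ n := g.2
  set x : Fin n ⊕ Unit → ℂ := Sum.elim (fun i => z.1 i) (fun _ => 1) with hx
  have key : ∀ y : Fin n ⊕ Unit → ℂ, star y ⬝ᵥ (formJ n).mulVec y =
      ((∑ i, ‖y (.inl i)‖ ^ 2 - ‖y (.inr ())‖ ^ 2 : ℝ) : ℂ) := by
    intro y
    simp [formJ, dotProduct, Matrix.mulVec, Fintype.sum_sum_type, Matrix.one_apply,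
      Complex.conj_mul', sub_eq_add_neg]
  have h1 : star x ⬝ᵥ (formJ n).mulVec x =
      star (g.1.1.mulVec x) ⬝ᵥ (formJ n).mulVec (g.1.1.mulVec x) := by
    conv_lhs => rw [← hg]
    rw [Matrix.star_mulVec, ← Matrix.mulVec_mulVec, ← Matrix.mulVec_mulVec,
      Matrix.dotProduct_mulVec]
  rw [key, key] at h1
  have h2 := Complex.ofReal_injective h1
  have h3 : ∀ i, g.1.1.mulVec x (.inl i) = num g z i := by
    intro i; simp [Matrix.mulVec, dotProduct, num, hx]
  have h4 : g.1.1.mulVec x (.inr ()) = den g z := by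
    simp [Matrix.mulVec, dotProduct, den, hx]
  simp only [h3, h4] at h2
  rw [← h2, EuclideanSpace.norm_sq_eq]
  simp [hx]

theorem den_ne_zero (g : SU n) (z : Ball n) : den g z ≠ 0 := by
  intro h
  have h1 := norm_num_den g z
  have h2 : ‖z.1‖ ^ 2 < 1 := by
    have := z.2
    have := norm_nonneg z.1
    nlinarith
  have h3 : 0 ≤ ∑ i, ‖num g z i‖ ^ 2 := Finset.sum_nonneg fun i _ => by positivity
  rw [h] at h1
  simp at h1
  linarith

/-- The action of `SU(n,1)` on the ball: `g • z = (a z + v) / (wᵗ z + d)`. -/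
def act (g : SU n) (z : Ball n) : Ball n :=
  ⟨WithLp.toLp 2 fun i => num g z i / den g z, by
    have h1 := norm_num_den g z
    have h2 : ‖z.1‖ ^ 2 < 1 := by
      have := z.2
      have := norm_nonneg z.1
      nlinarith
    have h0 : 0 < ‖den g z‖ ^ 2 := by
      have := norm_pos_iff.mpr (den_ne_zero g z)
      positivity
    refine lt_of_pow_lt_pow_left₀ 2 zero_le_one ?_
    rw [EuclideanSpace.norm_sq_eq]
    simp only [norm_div, div_pow, ← Finset.sum_div, one_pow]
    rw [div_lt_one h0]
    linarith⟩

/-! ### The lifted automorphy factor -/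

/-- The path `t ↦ wᵗ z + d` in `ℂ \ {0}` attached to a path `t ↦ γ t` in `SU(n,1)`. -/
def denPath (z : Ball n) : C(SU n, {c : ℂ // c ≠ 0}) where
  toFun g := ⟨den g z, den_ne_zero g z⟩
  continuous_toFun := by
    refine Continuous.subtype_mk ?_ _
    have h : ∀ i j, Continuous fun g : SU n => g.1.1 i j := fun i j =>
      have h1 : Continuous fun A : Matrix.SpecialLinearGroup (Fin n ⊕ Unit) ℂ => A.1 :=
        continuous_subtype_val
      (h1.comp continuous_subtype_val).matrix_elem i j
    unfold den
    exact (continuous_finsetSum _ fun k _ => (h _ _).mul continuous_const).add (h _ _)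

theorem denPath_zero (γ : BasedPaths (SU n)) (z : Ball n) :
    ((denPath z).comp (γ : C(I, SU n))) 0 = ⟨Complex.exp 0, Complex.exp_ne_zero 0⟩ := by
  have h : (γ : C(I, SU n)) 0 = 1 := γ.2
  ext
  simp [denPath, den, h]

/-- The value at time `1` of the continuous logarithm of `t ↦ wᵗ z + d` along the path `γ` that
vanishes at time `0`. -/
def logDenPath (γ : BasedPaths (SU n)) (z : Ball n) : ℂ :=
  Complex.isCoveringMap_exp.liftPath ((denPath z).comp (γ : C(I, SU n))) 0 (denPath_zero γ z) 1

/-- The lift of `log (wᵗ z + d)` to the universal covering group of `SU(n,1)`; for each `z` it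
vanishes at the identity and is continuous along paths. -/
def logDen (g : UniversalCover (SU n)) (z : Ball n) : ℂ :=
  Quotient.liftOn' g (fun γ => logDenPath γ z) (fun γ γ' h => by
    have h1 : (γ : C(I, SU n)).HomotopicRel (γ' : C(I, SU n)) {0, 1} :=
      (mk_eq_mk_iff γ γ').1 (Quotient.sound' h)
    exact Complex.isCoveringMap_exp.liftPath_apply_one_eq_of_homotopicRel
      (h1.map fun F => F.compContinuousMap (denPath z)) 0 _ _)

/-- The lifted logarithm is a logarithm of `wᵗ z + d`. -/
theorem exp_logDen (g : UniversalCover (SU n)) (z : Ball n) :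
    Complex.exp (logDen g z) = den (UniversalCover.proj g) z := by
  induction g using QuotientGroup.induction_on with
  | H γ =>
    have h := congrFun (Complex.isCoveringMap_exp.liftPath_lifts
      ((denPath z).comp (γ : C(I, SU n))) 0 (denPath_zero γ z)) 1
    exact congrArg Subtype.val h

/-- `j_λ(g, z) = (wᵗ z + d)^(-λ)`, lifted to the universal covering group of `SU(n,1)`. -/
def j (lam : ℝ) (g : UniversalCover (SU n)) (z : Ball n) : ℂ :=
  Complex.exp (-(lam : ℂ) * logDen g z)

/-- The action of the universal covering group on the ball, through `SU(n,1)`. -/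
def actCover (g : UniversalCover (SU n)) (z : Ball n) : Ball n :=
  act (UniversalCover.proj g) z

/-! ### The weighted Bergman space `A²_λ` -/

/-- The kernel `K_λ(z, w) = (1 - ⟨z, w⟩)^(-λ)`, `⟨z, w⟩ = ∑ zᵢ conj wᵢ`, with the principal branch
(the real part of `1 - ⟨z, w⟩` is positive on the ball). -/
def bergmanKernel (lam : ℝ) (z w : Ball n) : ℂ :=
  (1 - ∑ i, z.1 i * conj (w.1 i)) ^ (-(lam : ℂ))

/-- The same kernel, as an operator-valued kernel on the one-dimensional space `ℂ`. -/
def bergmanMatrix (n : ℕ) (lam : ℝ) : Matrix (Ball n) (Ball n) (ℂ →L[ℂ] ℂ) :=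
  Matrix.of fun z w => bergmanKernel lam z w • ContinuousLinearMap.id ℂ ℂ

theorem norm_dot_lt_one (z w : Ball n) : ‖∑ i, z.1 i * conj (w.1 i)‖ < 1 := by
  have h : ∑ i, z.1 i * conj (w.1 i) = inner ℂ w.1 z.1 := by
    simp [PiLp.inner_apply]
  rw [h]
  refine (norm_inner_le_norm _ _).trans_lt ?_
  have := z.2
  have := w.2
  have := norm_nonneg z.1
  have := norm_nonneg w.1
  nlinarith

theorem hasSum_bergmanKernel (lam : ℝ) (z w : Ball n) :
    HasSum (fun m : ℕ => ((Ring.choose (lam + m - 1) m : ℝ) : ℂ) *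
      (∑ i, z.1 i * conj (w.1 i)) ^ m) (bergmanKernel lam z w) := by
  have h := (Complex.one_div_one_sub_cpow_hasFPowerSeriesOnBall_zero (lam : ℂ)).hasSum
    (y := ∑ i, z.1 i * conj (w.1 i)) (by
      rw [← ENNReal.ofReal_one, Metric.eball_ofReal]
      simpa using norm_dot_lt_one z w)
  simp only [zero_add, FormalMultilinearSeries.ofScalars_apply_eq, smul_eq_mul] at h
  rw [bergmanKernel, Complex.cpow_neg, ← one_div]
  have e : ∀ m : ℕ, ((Ring.choose (lam + m - 1) m : ℝ) : ℂ) =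
      Ring.choose ((lam : ℂ) + m - 1) m := by
    intro m
    rw [Complex.ofReal_choose]
    push_cast
    rfl
  simpa only [e] using h

theorem choose_nonneg {lam : ℝ} (hlam : 0 < lam) (m : ℕ) :
    0 ≤ Ring.choose (lam + m - 1) m := by
  rw [← Ring.multichoose_eq]
  have h := Ring.factorial_nsmul_multichoose_eq_ascPochhammer lam m
  rw [Polynomial.ascPochhammer_smeval_eq_eval, nsmul_eq_mul] at h
  have h1 : 0 < (ascPochhammer ℝ m).eval lam := ascPochhammer_pos m lam hlam
  have h2 : (0 : ℝ) < (m.factorial : ℝ) := by exact_mod_cast m.factorial_pos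
  rw [← h] at h1
  exact (pos_of_mul_pos_right h1 h2.le).le

open scoped ComplexOrder in
/-- The kernel `K_λ` is positive semidefinite for `λ > 0`. -/
theorem posSemidef_bergmanMatrix (n : ℕ) {lam : ℝ} (hlam : 0 < lam) :
    (bergmanMatrix n lam).PosSemidef := by
  have hconj : ∀ z w : Ball n, conj (bergmanKernel lam z w) = bergmanKernel lam w z := by
    intro z w
    refine HasSum.unique ?_ (hasSum_bergmanKernel lam w z)
    convert Complex.hasSum_conj'.2 (hasSum_bergmanKernel lam z w) using 2 with m
    simp [mul_comm]
  have tf : (bergmanMatrix n lam).PosSemidef ↔ (bergmanMatrix n lam).IsHermitian ∧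
      ∀ vv : Ball n →₀ ℂ, 0 ≤ RCLike.re (vv.sum fun x a => vv.sum fun x' b =>
        inner ℂ (bergmanMatrix n lam x' x a) b) :=
    (RKHS.posSemidef_tfae (K := bergmanMatrix n lam)).out 0 2
  refine tf.2 ⟨?_, fun vv => ?_⟩
  · ext z w
    simp [bergmanMatrix, Matrix.conjTranspose_apply, hconj, star_smul,
      ContinuousLinearMap.star_eq_adjoint, ContinuousLinearMap.adjoint_id]
  · have h1 : ∀ z w : Ball n, ∀ a b : ℂ, inner ℂ (bergmanMatrix n lam w z a) b =
        conj a * b * bergmanKernel lam z w := by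
      intro z w a b
      simp [bergmanMatrix, hconj]
      ring
    simp only [h1, Finsupp.sum]
    have h2 : HasSum (fun m : ℕ => ∑ z ∈ vv.support, ∑ w ∈ vv.support, conj (vv z) * vv w *
        (((Ring.choose (lam + m - 1) m : ℝ) : ℂ) * (∑ i, z.1 i * conj (w.1 i)) ^ m))
        (∑ z ∈ vv.support, ∑ w ∈ vv.support, conj (vv z) * vv w * bergmanKernel lam z w) :=
      hasSum_sum fun z _ => hasSum_sum fun w _ => (hasSum_bergmanKernel lam z w).mul_left _
    have h3 := Complex.hasSum_re h2
    refine h3.nonneg fun m => ?_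
    have h4 : (∑ z ∈ vv.support, ∑ w ∈ vv.support, conj (vv z) * vv w *
        (((Ring.choose (lam + m - 1) m : ℝ) : ℂ) * (∑ i, z.1 i * conj (w.1 i)) ^ m)) =
        ((Ring.choose (lam + m - 1) m * ∑ p : Fin m → Fin n,
          ‖∑ w ∈ vv.support, vv w * ∏ i, conj (w.1 (p i))‖ ^ 2 : ℝ) : ℂ) := by
      have h5 : ∀ z w : Ball n, (∑ i, z.1 i * conj (w.1 i)) ^ m =
          ∑ p : Fin m → Fin n, (∏ i, z.1 (p i)) * ∏ i, conj (w.1 (p i)) := by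
        intro z w
        rw [Fintype.sum_pow]
        simp only [Finset.prod_mul_distrib]
      have h6 : ∀ p : Fin m → Fin n,
          ((‖∑ w ∈ vv.support, vv w * ∏ i, conj (w.1 (p i))‖ ^ 2 : ℝ) : ℂ) =
          ∑ z ∈ vv.support, ∑ w ∈ vv.support, conj (vv z) * vv w *
            ((∏ i, z.1 (p i)) * ∏ i, conj (w.1 (p i))) := by
        intro p
        push_cast
        rw [← Complex.conj_mul', map_sum, Finset.sum_mul_sum]
        refine Finset.sum_congr rfl fun z _ => Finset.sum_congr rfl fun w _ => ?_
        simp only [map_mul, map_prod, Complex.conj_conj]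
        ring
      rw [Complex.ofReal_mul, Complex.ofReal_sum]
      simp only [h5, h6]
      rw [Finset.sum_comm (s := Finset.univ), Finset.mul_sum]
      refine Finset.sum_congr rfl fun z _ => ?_
      rw [Finset.sum_comm (s := Finset.univ), Finset.mul_sum]
      refine Finset.sum_congr rfl fun w _ => ?_
      simp only [Finset.mul_sum]
      refine Finset.sum_congr rfl fun p _ => ?_
      ring
    rw [h4, Complex.ofReal_re]
    exact mul_nonneg (choose_nonneg hlam m) (Finset.sum_nonneg fun _ _ => by positivity)

/-- The weighted Bergman space `A²_λ` of the unit ball for `λ > 0`: the functions on the ball that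
belong to the reproducing kernel Hilbert space with kernel `K_λ(z, w) = (1 - ⟨z, w⟩)^(-λ)`. -/
def weightedBergman (n : ℕ) (lam : ℝ) (hlam : 0 < lam) : Submodule ℂ (Ball n → ℂ) :=
  haveI : Fact (bergmanMatrix n lam).PosSemidef := ⟨posSemidef_bergmanMatrix n hlam⟩
  LinearMap.range
    (RKHS.coeCLM ℂ (H := RKHS.OfKernel (bergmanMatrix n lam))).toLinearMap

/-! ### The representations and the restriction operator -/

/-- `π_λ(g) f (z) = j_λ(g⁻¹, z) f(g⁻¹ z)`. -/
def piRep (lam : ℝ) (g : UniversalCover (SU n)) (f : Ball n → ℂ) : Ball n → ℂ :=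
  fun z => j lam g⁻¹ z * f (actCover g⁻¹ z)

/-- The inverse image of a subgroup `H` of `SU(n,1)` in the universal covering group. -/
abbrev coverOf (H : Subgroup (SU n)) : Subgroup (UniversalCover (SU n)) :=
  H.comap UniversalCover.proj

/-- `D_λ(h) = j_λ(h, z₀)`. -/
def D (lam : ℝ) (H : Subgroup (SU n)) (z₀ : Ball n) (h : coverOf H) : ℂ :=
  j lam h z₀

/-- `χ_λ(k) = j_λ(k, z₀)⁻¹`; only its values for `k` in the stabilizer of `z₀` are used. -/
def chi (lam : ℝ) (H : Subgroup (SU n)) (z₀ : Ball n) (k : coverOf H) : ℂ :=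
  (j lam k z₀)⁻¹

/-- The functions `F` on the covering `H~` of `H` with `F(h k) = χ_λ(k)⁻¹ F(h)` for all `k` in the
stabilizer of `z₀` in `H~` (no regularity or integrability is imposed). -/
def equivariantFunctions (lam : ℝ) (H : Subgroup (SU n)) (z₀ : Ball n) :
    Submodule ℂ (coverOf H → ℂ) where
  carrier := {F | ∀ h k : coverOf H, actCover (k : UniversalCover (SU n)) z₀ = z₀ →
    F (h * k) = (chi lam H z₀ k)⁻¹ * F h}
  add_mem' {F K} hF hK h k hk := by
    simp only [Pi.add_apply, hF h k hk, hK h k hk, mul_add]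
  zero_mem' h k hk := by simp
  smul_mem' c F hF h k hk := by
    simp only [Pi.smul_apply, hF h k hk, smul_eq_mul]
    ring

/-- The restriction operator `R_λ f (h) = D_λ(h) f(h z₀)`, for `f` in `A²_λ`. -/
def restriction (lam : ℝ) (hlam : 0 < lam) (H : Subgroup (SU n)) (z₀ : Ball n) :
    weightedBergman n lam hlam →ₗ[ℂ] (coverOf H → ℂ) where
  toFun f h := D lam H z₀ h * f.1 (actCover (h : UniversalCover (SU n)) z₀)
  map_add' f g := by
    funext h
    simp [mul_add]
  map_smul' c f := by
    funext h
    simp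
    ring

/-- Left translation of functions on the covering `H~` of `H`: `(τ(h₁) F)(h) = F(h₁⁻¹ h)`. -/
def leftRegular (H : Subgroup (SU n)) (h₁ : coverOf H) (F : coverOf H → ℂ) : coverOf H → ℂ :=
  fun h => F (h₁⁻¹ * h)

end BallRestriction

end

namespace BallRestriction

variable {n : ℕ}

/-! Both identities are the cocycle rule `j_mul` combined with `actCover_mul`; the remaining content
is that `piRep` preserves the Bergman space.

The cocycle rule is additivity of lifted logarithms (`logDen_mul`). Along a product of paths `γ *
δ`, the logarithm for `γ * δ` minus that for `δ` is a logarithm of `den` along `γ` at the moving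
point `δ t • z`. By `logDen_eq_of_moving_point` only the final point matters.

For invariance, preservation of the Hermitian form gives a transformation rule for `1 - ⟨z, w⟩`. It
lifts to principal logarithms by uniqueness of continuous logarithms along a path, so the kernel
transforms by `j` (`bergmanKernel_actCover`). The vectors representing `f ↦ piRep lam g f z`
therefore have the same Gram matrix as the kernel vectors. Hence the kernel vectors map to them by
an isometry, whose adjoint is `piRep` (`exists_eq_inner_of_gram`). -/

/-! ### The fractional linear action and its cocycle -/

theorem num_mul (g h : SU n) (z : Ball n) (i : Fin n) :
    num (g * h) z i = num g (act h z) i * den h z := by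
  have hd := den_ne_zero h z
  have e : ∀ i j, (g * h).1.1 i j = ∑ k, g.1.1 i k * h.1.1 k j := fun i j => rfl
  simp only [num, act, e, Fintype.sum_sum_type, Finset.univ_unique, Finset.sum_singleton,
    add_mul, Finset.sum_mul, mul_assoc, div_mul_cancel₀ _ hd, Finset.sum_add_distrib,
    PUnit.default_eq_unit]
  simp only [den, mul_add, Finset.sum_add_distrib, Finset.mul_sum, add_assoc]
  rw [Finset.sum_comm]
  ring

/-- The pair `(num h z, den h z)` is `h` applied to `(z, 1)`, that is, `den h z` times the vector
`(act h z, 1)`. Applying `g` and reading off the last coordinate gives the rule; `num_mul` reads off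
the others. -/
theorem den_mul (g h : SU n) (z : Ball n) :
    den (g * h) z = den g (act h z) * den h z := by
  have hd := den_ne_zero h z
  have e : ∀ i j, (g * h).1.1 i j = ∑ k, g.1.1 i k * h.1.1 k j := fun i j => rfl
  have e1 : den g (act h z) * den h z = ∑ k, g.1.1 (.inr ()) (.inl k) * num h z k +
      g.1.1 (.inr ()) (.inr ()) * den h z := by
    rw [den, add_mul, Finset.sum_mul]
    simp only [act, mul_assoc, div_mul_cancel₀ _ hd]
  rw [e1]
  simp only [den, num, e, Fintype.sum_sum_type, Finset.univ_unique, Finset.sum_singleton,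
    add_mul, Finset.sum_mul, mul_assoc, Finset.sum_add_distrib,
    PUnit.default_eq_unit, mul_add, Finset.mul_sum, add_assoc]
  rw [Finset.sum_comm]
  ring

theorem act_mul (g h : SU n) (z : Ball n) : act (g * h) z = act g (act h z) := by
  refine Subtype.ext (PiLp.ext fun i => ?_)
  change num (g * h) z i / den (g * h) z = num g (act h z) i / den g (act h z)
  rw [num_mul, den_mul, mul_div_mul_right _ _ (den_ne_zero h z)]

theorem den_one (z : Ball n) : den (1 : SU n) z = 1 := by simp [den]

theorem act_one (z : Ball n) : act (1 : SU n) z = z := by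
  refine Subtype.ext (PiLp.ext fun i => ?_)
  change num (1 : SU n) z i / den (1 : SU n) z = z.1 i
  simp [num, den_one, Matrix.one_apply]

theorem actCover_mul (g h : UniversalCover (SU n)) (z : Ball n) :
    actCover (g * h) z = actCover g (actCover h z) := by
  rw [actCover, map_mul, act_mul]; rfl

section Continuity

variable {X : Type*} [TopologicalSpace X] {g : X → SU n} {z : X → Ball n}

theorem continuous_entry (i k : Fin n ⊕ Unit) : Continuous fun g : SU n => g.1.1 i k := by
  have h1 : Continuous fun A : Matrix.SpecialLinearGroup (Fin n ⊕ Unit) ℂ => A.1 :=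
    continuous_subtype_val
  exact (h1.comp continuous_subtype_val).matrix_elem i k

theorem continuous_coord (i : Fin n) : Continuous fun z : Ball n => z.1 i := by fun_prop

theorem continuous_num (hg : Continuous g) (hz : Continuous z) (i : Fin n) :
    Continuous fun x => num (g x) (z x) i :=
  (continuous_finsetSum _ fun _ _ =>
    ((continuous_entry _ _).comp hg).mul ((continuous_coord _).comp hz)).add
    ((continuous_entry _ _).comp hg)

theorem continuous_den (hg : Continuous g) (hz : Continuous z) :
    Continuous fun x => den (g x) (z x) :=
  (continuous_finsetSum _ fun _ _ =>
    ((continuous_entry _ _).comp hg).mul ((continuous_coord _).comp hz)).add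
    ((continuous_entry _ _).comp hg)

theorem continuous_act (hg : Continuous g) (hz : Continuous z) :
    Continuous fun x => act (g x) (z x) :=
  ((PiLp.continuous_toLp 2 _).comp (continuous_pi fun i =>
    (continuous_num hg hz i).div (continuous_den hg hz) fun _ => den_ne_zero _ _)).subtype_mk _

end Continuity

/-! ### Lifted logarithms and the cocycle identity -/

/-- Two continuous logarithms of the same function on a connected space that agree at a point are
equal. -/
theorem eq_of_exp_eq {X : Type*} [TopologicalSpace X] [PreconnectedSpace X] {a b : X → ℂ}
    (ha : Continuous a) (hb : Continuous b) (h : ∀ x, Complex.exp (a x) = Complex.exp (b x))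
    (x₀ : X) (h₀ : a x₀ = b x₀) : a = b :=
  Complex.isCoveringMap_exp.eq_of_comp_eq ha hb (funext fun x => Subtype.ext (h x)) x₀ h₀

/-- The continuous logarithm of `t ↦ wᵗ z + d` along a path in `SU(n,1)`. -/
theorem exists_log_path (γ : BasedPaths (SU n)) (z : Ball n) :
    ∃ L : C(I, ℂ), (∀ t, Complex.exp (L t) = den ((γ : C(I, SU n)) t) z) ∧ L 0 = 0 ∧
      L 1 = logDen (QuotientGroup.mk γ) z :=
  ⟨Complex.isCoveringMap_exp.liftPath ((denPath z).comp (γ : C(I, SU n))) 0 (denPath_zero γ z),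
    fun t => congrArg Subtype.val (congrFun (Complex.isCoveringMap_exp.liftPath_lifts
      ((denPath z).comp (γ : C(I, SU n))) 0 (denPath_zero γ z)) t),
    Complex.isCoveringMap_exp.liftPath_zero _ _ _, rfl⟩

/-- The lifted logarithm may be computed along any path in `SU(n,1) × 𝔹ⁿ` over the given path in
`SU(n,1)`. -/
theorem logDen_eq_of_moving_point (γ : BasedPaths (SU n)) (ζ : C(I, Ball n)) (L : C(I, ℂ))
    (hL : ∀ t, Complex.exp (L t) = den ((γ : C(I, SU n)) t) (ζ t)) (hL0 : L 0 = 0) :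
    L 1 = logDen (QuotientGroup.mk γ) (ζ 1) := by
  have hγ : (γ : C(I, SU n)) 0 = 1 := γ.2
  set p : C(I, {c : ℂ // c ≠ 0}) :=
    ⟨fun t => ⟨den ((γ : C(I, SU n)) t) (ζ t), den_ne_zero _ _⟩,
      (continuous_den (γ : C(I, SU n)).continuous ζ.continuous).subtype_mk _⟩ with hp
  have h0 : p 0 = ⟨Complex.exp 0, Complex.exp_ne_zero 0⟩ := by
    ext; simp [hp, hγ, den_one]
  have h1 : L = Complex.isCoveringMap_exp.liftPath p 0 h0 :=
    (Complex.isCoveringMap_exp.eq_liftPath_iff' h0).2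
      ⟨funext fun t => Subtype.ext (hL t), hL0⟩
  rw [h1]
  refine Complex.isCoveringMap_exp.liftPath_apply_one_eq_of_homotopicRel ?_ 0 _ _
  -- The parameter `max s t` deforms the moving point `ζ t` (`s = 0`) into the fixed point `ζ 1` (`s
  -- = 1`). Endpoints stay put: at `t = 0` the matrix is `1`, so `den` is `1` at every point; at `t
  -- = 1` the maximum is `1`.
  refine ⟨{ toFun := fun q => ⟨den ((γ : C(I, SU n)) q.2) (ζ (max q.1 q.2)), den_ne_zero _ _⟩
            continuous_toFun := (continuous_den (by fun_prop) (by fun_prop)).subtype_mk _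
            map_zero_left := fun t => ?_
            map_one_left := fun t => ?_
            prop' := fun s t ht => ?_ }⟩
  · simp [hp]
  · simp [denPath, max_eq_left (unitInterval.le_one' (t := t))]
  · rcases ht with rfl | rfl
    · ext; simp [hp, hγ, den_one]
    · ext; simp [hp, max_eq_right (unitInterval.le_one' (t := s))]

theorem logDen_mul (g h : UniversalCover (SU n)) (z : Ball n) :
    logDen (g * h) z = logDen g (actCover h z) + logDen h z := by
  induction g using QuotientGroup.induction_on with
  | H γ =>
  induction h using QuotientGroup.induction_on with
  | H δ =>
  obtain ⟨L, hL, hL0, hL1⟩ := exists_log_path (γ * δ) z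
  obtain ⟨M, hM, hM0, hM1⟩ := exists_log_path δ z
  have key := logDen_eq_of_moving_point γ
    ⟨fun t => act ((δ : C(I, SU n)) t) z,
      continuous_act (δ : C(I, SU n)).continuous continuous_const⟩ (L - M)
    (fun t => by
      have e := hL t
      change _ = den ((γ : C(I, SU n)) t * (δ : C(I, SU n)) t) z at e
      rw [den_mul] at e
      rw [ContinuousMap.sub_apply, Complex.exp_sub, e, hM, mul_div_cancel_right₀ _ (den_ne_zero _ _)]
      rfl)
    (by simp [hL0, hM0])
  rw [ContinuousMap.sub_apply, hL1, hM1] at key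
  exact sub_eq_iff_eq_add.1 key

/-- The cocycle identity for the lifted automorphy factor. -/
theorem j_mul (lam : ℝ) (g h : UniversalCover (SU n)) (z : Ball n) :
    j lam (g * h) z = j lam g (actCover h z) * j lam h z := by
  rw [j, j, j, logDen_mul, mul_add, Complex.exp_add]

/-! ### Invariance of the kernel -/

/-- The polarized form of `norm_num_den`: `g` preserves the Hermitian pairing of `(z, 1)` and `(w,
1)`. -/
theorem sum_num_sub_den (g : SU n) (z w : Ball n) :
    ∑ i, num g z i * conj (num g w i) - den g z * conj (den g w) =
      ∑ i, z.1 i * conj (w.1 i) - 1 := by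
  have hg : (g.1.1).conjTranspose * formJ n * g.1.1 = formJ n := g.2
  set x : Ball n → Fin n ⊕ Unit → ℂ := fun z => Sum.elim (fun i => z.1 i) (fun _ => 1) with hx
  have key : ∀ y u : Fin n ⊕ Unit → ℂ, star y ⬝ᵥ (formJ n).mulVec u =
      ∑ i, u (.inl i) * conj (y (.inl i)) - u (.inr ()) * conj (y (.inr ())) := by
    intro y u
    simp [formJ, dotProduct, Matrix.mulVec, Fintype.sum_sum_type, Matrix.one_apply,
      sub_eq_add_neg, mul_comm]
  have h1 : star (x w) ⬝ᵥ (formJ n).mulVec (x z) =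
      star (g.1.1.mulVec (x w)) ⬝ᵥ (formJ n).mulVec (g.1.1.mulVec (x z)) := by
    conv_lhs => rw [← hg]
    rw [Matrix.star_mulVec, ← Matrix.mulVec_mulVec, ← Matrix.mulVec_mulVec,
      Matrix.dotProduct_mulVec]
  have h3 : ∀ z i, g.1.1.mulVec (x z) (.inl i) = num g z i := by
    intro z i; simp [Matrix.mulVec, dotProduct, num, hx]
  have h4 : ∀ z, g.1.1.mulVec (x z) (.inr ()) = den g z := by
    intro z; simp [Matrix.mulVec, dotProduct, den, hx]
  rw [key, key] at h1
  simp only [h3, h4] at h1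
  rw [← h1]
  simp [hx]

theorem one_sub_dot_act (g : SU n) (z w : Ball n) :
    den g z * conj (den g w) * (1 - ∑ i, (act g z).1 i * conj ((act g w).1 i)) =
      1 - ∑ i, z.1 i * conj (w.1 i) := by
  have hz := den_ne_zero g z
  have hw : conj (den g w) ≠ 0 := (map_ne_zero _).2 (den_ne_zero g w)
  have e : ∀ i, den g z * conj (den g w) * ((act g z).1 i * conj ((act g w).1 i)) =
      num g z i * conj (num g w i) := by
    intro i
    change den g z * conj (den g w) * (num g z i / den g z * conj (num g w i / den g w)) = _
    rw [map_div₀]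
    field_simp
  rw [mul_sub, Finset.mul_sum]
  simp only [e]
  linear_combination -(sum_num_sub_den g z w)

theorem one_sub_dot_mem_slitPlane (z w : Ball n) :
    1 - ∑ i, z.1 i * conj (w.1 i) ∈ Complex.slitPlane := by
  left
  have h1 := norm_dot_lt_one z w
  have h2 := Complex.re_le_norm (∑ i, z.1 i * conj (w.1 i))
  rw [Complex.sub_re, Complex.one_re]
  linarith

/-- Exponentiating gives `one_sub_dot_act`, which fixes the identity only modulo `2πi`. Along a path
representing `g` both sides are continuous, since `1 - ⟨·, ·⟩` never leaves the slit plane, and they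
agree at time `0`, so the branches match. -/
theorem log_one_sub_dot_actCover (g : UniversalCover (SU n)) (z w : Ball n) :
    Complex.log (1 - ∑ i, (actCover g z).1 i * conj ((actCover g w).1 i)) =
      Complex.log (1 - ∑ i, z.1 i * conj (w.1 i)) - logDen g z - conj (logDen g w) := by
  induction g using QuotientGroup.induction_on with
  | H γ =>
  obtain ⟨L, hL, hL0, hL1⟩ := exists_log_path γ z
  obtain ⟨M, hM, hM0, hM1⟩ := exists_log_path γ w
  have hγ : (γ : C(I, SU n)) 0 = 1 := γ.2
  have hact : ∀ z : Ball n, ∀ i, Continuous fun t => (act ((γ : C(I, SU n)) t) z).1 i :=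
    fun z i => (continuous_coord i).comp
      (continuous_act (γ : C(I, SU n)).continuous continuous_const)
  have key := eq_of_exp_eq (X := I)
    (a := fun t => Complex.log (1 - ∑ i, (act ((γ : C(I, SU n)) t) z).1 i *
      conj ((act ((γ : C(I, SU n)) t) w).1 i)))
    (b := fun t => Complex.log (1 - ∑ i, z.1 i * conj (w.1 i)) - L t - conj (M t))
    (Continuous.clog (continuous_const.sub (continuous_finsetSum _ fun i _ =>
      (hact z i).mul (Complex.continuous_conj.comp (hact w i))))
      fun t => one_sub_dot_mem_slitPlane _ _)
    ((continuous_const.sub L.continuous).sub (Complex.continuous_conj.comp M.continuous))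
    (fun t => by
      rw [Complex.exp_log (Complex.slitPlane_ne_zero (one_sub_dot_mem_slitPlane _ _)),
        Complex.exp_sub, Complex.exp_sub,
        Complex.exp_log (Complex.slitPlane_ne_zero (one_sub_dot_mem_slitPlane _ _)),
        Complex.exp_conj, hL, hM, ← one_sub_dot_act ((γ : C(I, SU n)) t) z w]
      have hz := den_ne_zero ((γ : C(I, SU n)) t) z
      have hw : conj (den ((γ : C(I, SU n)) t) w) ≠ 0 := (map_ne_zero _).2 (den_ne_zero _ w)
      field_simp)
    0 (by simp only [hγ, act_one, hL0, hM0, map_zero, sub_zero])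
  have h1 := congrFun key 1
  simp only [hL1, hM1] at h1
  exact h1

/-- The transformation rule of the kernel under the universal covering group of `SU(n,1)`. -/
theorem bergmanKernel_actCover (lam : ℝ) (g : UniversalCover (SU n)) (z w : Ball n) :
    j lam g z * conj (j lam g w) * bergmanKernel lam (actCover g z) (actCover g w) =
      bergmanKernel lam z w := by
  rw [bergmanKernel, bergmanKernel,
    Complex.cpow_def_of_ne_zero (Complex.slitPlane_ne_zero (one_sub_dot_mem_slitPlane _ _)),
    Complex.cpow_def_of_ne_zero (Complex.slitPlane_ne_zero (one_sub_dot_mem_slitPlane _ _)),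
    log_one_sub_dot_actCover, j, j, ← Complex.exp_conj, ← Complex.exp_add, ← Complex.exp_add]
  congr 1
  simp only [map_mul, map_neg, Complex.conj_ofReal]
  ring

/-! ### Stability of the Bergman space -/

/-- Functions represented by a system of vectors whose Gram matrix is the kernel belong to the
reproducing kernel Hilbert space. -/
theorem exists_eq_inner_of_gram {X H : Type*} [NormedAddCommGroup H] [InnerProductSpace ℂ H]
    [CompleteSpace H] [RKHS ℂ H X ℂ] (ψ : X → H)
    (hψ : ∀ x y, inner ℂ (ψ x) (ψ y) = inner ℂ (RKHS.kerFun H x 1) (RKHS.kerFun H y 1)) (F : H) :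
    ∃ G : H, ∀ x, G x = inner ℂ (ψ x) F := by
  set k : X → H := fun x => RKHS.kerFun H x 1 with hk
  set e := Finsupp.linearCombination ℂ k with he
  set T := Finsupp.linearCombination ℂ ψ with hT
  have hdense : DenseRange e := by
    have h1 : (Submodule.span ℂ {RKHS.kerFun H x v | (x : X) (v : ℂ)}) ≤ LinearMap.range e := by
      rw [Submodule.span_le]
      rintro _ ⟨x, v, rfl⟩
      refine ⟨Finsupp.single x v, ?_⟩
      rw [he, Finsupp.linearCombination_single, hk, ← map_smul, smul_eq_mul, mul_one]
    have h2 : (LinearMap.range e).topologicalClosure = ⊤ :=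
      top_le_iff.1 ((RKHS.kerFun_dense H).ge.trans (Submodule.topologicalClosure_mono h1))
    have h3 := (Submodule.dense_iff_topologicalClosure_eq_top (s := LinearMap.range e)).2 h2
    rwa [LinearMap.coe_range] at h3
  -- Equal Gram matrices give equal norms of formal combinations. So `e c ↦ T c` is well defined
  -- despite possible linear relations among the `k x`, and it extends isometrically by density.
  have hnorm : ∀ c, ‖T c‖ = ‖e c‖ := by
    intro c
    have : (inner ℂ (T c) (T c) : ℂ) = inner ℂ (e c) (e c) := by
      simp only [hT, he, Finsupp.linearCombination_apply, Finsupp.sum_inner, Finsupp.inner_sum,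
        hψ, inner_smul_left, inner_smul_right, hk]
    rw [inner_self_eq_norm_sq_to_K, inner_self_eq_norm_sq_to_K] at this
    have h2 : ‖T c‖ ^ 2 = ‖e c‖ ^ 2 := by exact_mod_cast this
    exact (pow_left_inj₀ (norm_nonneg _) (norm_nonneg _) two_ne_zero).1 h2
  refine ⟨(T.extendOfNorm e).adjoint F, fun x => ?_⟩
  have h1 := RKHS.kerFun_inner (H := H) x (1 : ℂ) ((T.extendOfNorm e).adjoint F)
  have h2 : T.extendOfNorm e (k x) = ψ x := by
    have := LinearMap.extendOfNorm_eq hdense ⟨1, fun c => by rw [hnorm, one_mul]⟩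
      (f := T) (Finsupp.single x 1)
    simpa [he, hT] using this
  rw [ContinuousLinearMap.adjoint_inner_right, h2] at h1
  rw [h1]
  simp

theorem piRep_mem_weightedBergman {lam : ℝ} (hlam : 0 < lam) (g : UniversalCover (SU n))
    {f : Ball n → ℂ} (hf : f ∈ weightedBergman n lam hlam) :
    piRep lam g f ∈ weightedBergman n lam hlam := by
  have : Fact (bergmanMatrix n lam).PosSemidef := ⟨posSemidef_bergmanMatrix n hlam⟩
  obtain ⟨F, rfl⟩ := hf
  have hker : ∀ z w : Ball n, inner ℂ (RKHS.kerFun (RKHS.OfKernel (bergmanMatrix n lam)) z 1)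
      (RKHS.kerFun (RKHS.OfKernel (bergmanMatrix n lam)) w 1) = bergmanKernel lam z w := by
    intro z w
    rw [RKHS.kerFun_inner, RKHS.kerFun_apply, RKHS.OfKernel.kernel_ofKernel]
    simp [bergmanMatrix]
  -- The inner product is conjugate linear in its first argument, so the conjugate on `j` makes
  -- pairing with `F` return `j lam g⁻¹ z * F (actCover g⁻¹ z)`.
  obtain ⟨G, hG⟩ := exists_eq_inner_of_gram
    (fun z => conj (j lam g⁻¹ z) •
      RKHS.kerFun (RKHS.OfKernel (bergmanMatrix n lam)) (actCover g⁻¹ z) 1)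
    (fun z w => by
      rw [inner_smul_left, inner_smul_right, hker, hker, Complex.conj_conj, ← mul_assoc,
        bergmanKernel_actCover]) F
  refine ⟨G, funext fun z => ?_⟩
  refine (hG z).trans ?_
  rw [inner_smul_left, RKHS.kerFun_inner, Complex.conj_conj]
  simp [piRep]

end BallRestriction

/-! ### Equivariance and the intertwining property -/

theorem mainTheorem10 (n : ℕ) (lam : ℝ) (hlam : 0 < lam)
    (H : Subgroup (BallRestriction.SU n)) (z₀ : BallRestriction.Ball n)
    (f : BallRestriction.weightedBergman n lam hlam) :
    BallRestriction.restriction lam hlam H z₀ f ∈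
        BallRestriction.equivariantFunctions lam H z₀ ∧
      ∀ h₁ : BallRestriction.coverOf H,
        ∃ hf : BallRestriction.piRep lam (h₁ : BallRestriction.UniversalCover (BallRestriction.SU n))
            (f : BallRestriction.Ball n → ℂ) ∈ BallRestriction.weightedBergman n lam hlam,
          ∀ h : BallRestriction.coverOf H,
            BallRestriction.restriction lam hlam H z₀
                ⟨BallRestriction.piRep lam
                  (h₁ : BallRestriction.UniversalCover (BallRestriction.SU n))
                  (f : BallRestriction.Ball n → ℂ), hf⟩ h =
              BallRestriction.leftRegular H h₁ (BallRestriction.restriction lam hlam H z₀ f) h := by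
  have hmem := fun h₁ : BallRestriction.coverOf H =>
    BallRestriction.piRep_mem_weightedBergman hlam h₁.1 f.2
  refine ⟨fun h k hk => ?_, fun h₁ => ⟨hmem h₁, fun h => ?_⟩⟩
  · change BallRestriction.j lam (h.1 * k.1) z₀ * f.1 (BallRestriction.actCover (h.1 * k.1) z₀) =
      (BallRestriction.j lam k.1 z₀)⁻¹⁻¹ *
        (BallRestriction.j lam h.1 z₀ * f.1 (BallRestriction.actCover h.1 z₀))
    rw [BallRestriction.j_mul, BallRestriction.actCover_mul, hk, inv_inv]
    ring
  · change BallRestriction.j lam h.1 z₀ *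
        (BallRestriction.j lam h₁.1⁻¹ (BallRestriction.actCover h.1 z₀) *
          f.1 (BallRestriction.actCover h₁.1⁻¹ (BallRestriction.actCover h.1 z₀))) =
      BallRestriction.j lam (h₁.1⁻¹ * h.1) z₀ *
        f.1 (BallRestriction.actCover (h₁.1⁻¹ * h.1) z₀)
    rw [BallRestriction.j_mul, BallRestriction.actCover_mul]
    ring
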